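/- **Definitions.** A circular $r$-edge-colouring of a loopless multigraph $G$ (where $r\ge 1$ is real) assigns to every edge a colour in $[0,r)$ so that the colours $s,t$ of any two distinct edges with a common end satisfy $1\le |s-t|\le r-1$; the circular chromatic index $\chi_c'(G)$ of a finite loopless multigraph $G$ is the infimum of all $r$ for which $G$ has a circular $r$-edge-colouring. $G$ is $\chi_c'$-critical if $\chi_c'(G')<\chi_c'(G)$ for every proper subgraph $G'$ of $G$. Let $H$ be the multigraph with vertices $0,1,\dots,9$ and the following $23$ edges (a pair that is listed twice stands for two parallel edges; the sparse6 code of $H$ is `:Ig?COaaGS?aEQ?QDL?PAe`): $$04,\,04,\,15,\,15,\,25,\,16,\,26,\,26,\,07,\,17,\,27,\,37,\,47,\,08,\,18,\,48,\,58,\,68,\,09,\,29,\,49,\,59,\,69.$$ For $k\ge 2$, let $G_k$ be the multigraph obtained from a cycle of length $2k$ and $2k$ disjoint copies of $H$ by identifying each vertex of the cycle with the vertex $3$ of exactly one of the copies of $H$ (with a different copy for each vertex). **Theorem.** There exist infinitely many pairwise non-isomorphic finite multigraphs $G$ with maximum degree $\Delta(G)=5$, edge connectivity $1$ and $\chi_c'(G)=5+\tfrac34=\tfrac{23}{4}$.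 More precisely: 1. $\chi_c'(H)=\tfrac{23}{4}$, $H$ is $\chi_c'$-critical, and its vertex $3$ has degree $1$. 2. For every $k\ge 2$, the finite multigraph $G_k$ has $\Delta(G_k)=5$, edge connectivity $1$ and $\chi_c'(G_k)=\tfrac{23}{4}$. 3. The multigraphs $G_k$, $k\ge 2$, are pairwise non-isomorphic. -/

import Mathlib

namespace Graph

/-- An isomorphism of multigraphs: a bijection of the vertices and a bijection of the edges
that preserve the ends of every edge. -/
structure Iso {α β α' β' : Type*} (G : Graph α β) (G' : Graph α' β') where
  vertexEquiv : G.vertexSet ≃ G'.vertexSet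
  edgeEquiv : G.edgeSet ≃ G'.edgeSet
  isLink_iff : ∀ (e : G.edgeSet) (x y : G.vertexSet),
    G'.IsLink (edgeEquiv e) (vertexEquiv x) (vertexEquiv y) ↔ G.IsLink e x y

/-- The degree of a vertex: the number of edges incident with it, loops counting twice. -/
noncomputable def degree {α β : Type*} (G : Graph α β) (x : α) : ℕ∞ :=
  (G.incidenceSet x).encard + (G.loopSet x).encard

/-- The maximum degree of a multigraph. -/
noncomputable def maxDegree {α β : Type*} (G : Graph α β) : ℕ∞ :=
  ⨆ x ∈ G.vertexSet, G.degree x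

/-- A multigraph is connected if it has a vertex and any two of its vertices are joined by
a walk. -/
def Connected {α β : Type*} (G : Graph α β) : Prop :=
  G.vertexSet.Nonempty ∧
    ∀ x ∈ G.vertexSet, ∀ y ∈ G.vertexSet, Relation.ReflTransGen G.Adj x y

/-- A multigraph is `k`-edge-connected if it has at least two vertices and cannot be
disconnected by the removal of fewer than `k` edges. -/
def IsEdgeConnected {α β : Type*} (G : Graph α β) (k : ℕ∞) : Prop :=
  G.vertexSet.Nontrivial ∧
    ∀ F : Set β, F ⊆ G.edgeSet → F.encard < k → (G.deleteEdges F).Connected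

/-- The edge connectivity: the largest `k` such that the multigraph is `k`-edge-connected
(and `0` if there is none). -/
noncomputable def edgeConnectivity {α β : Type*} (G : Graph α β) : ℕ∞ :=
  sSup {k : ℕ∞ | G.IsEdgeConnected k}

/-- `c` is a circular `r`-edge-colouring of `G`: every edge gets a colour in `[0, r)`, and any two
distinct edges with a common end get colours `s`, `t` with `1 ≤ |s - t| ≤ r - 1`. A multigraph
with a loop has no circular edge-colouring. -/
structure IsCircularEdgeColoring {α β : Type*} (G : Graph α β) (r : ℝ) (c : β → ℝ) : Prop where
  not_isLoopAt : ∀ e x, ¬ G.IsLoopAt e x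
  mem_Ico : ∀ e ∈ G.edgeSet, c e ∈ Set.Ico 0 r
  dist : ∀ e f x, e ≠ f → G.Inc e x → G.Inc f x → 1 ≤ |c e - c f| ∧ |c e - c f| ≤ r - 1

/-- The circular chromatic index: the infimum of all `r` such that `G` has a circular
`r`-edge-colouring. As usual, only circumferences `r ≥ 1` are considered; this is automatic when
two edges of `G` have a common end, and gives the value `1` otherwise. -/
noncomputable def circularChromaticIndex {α β : Type*} (G : Graph α β) : ℝ :=
  sInf {r : ℝ | 1 ≤ r ∧ ∃ c : β → ℝ, G.IsCircularEdgeColoring r c}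

/-- A multigraph is critical for the circular chromatic index if every proper subgraph has a
smaller circular chromatic index. -/
def IsCircularChromaticIndexCritical {α β : Type*} (G : Graph α β) : Prop :=
  ∀ G' : Graph α β, G' < G → G'.circularChromaticIndex < G.circularChromaticIndex

/-- The multigraph with vertex type `α` and edge type `β` in which the edge `e` has the
pair of ends `ends e`. -/
def ofEnds {α β : Type*} (ends : β → Sym2 α) : Graph α β where
  vertexSet := Set.univ
  edgeSet := Set.univ
  IsLink e x y := ends e = s(x, y)
  isLink_symm _ _ := ⟨fun _ _ h => h.trans Sym2.eq_swap⟩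
  eq_or_eq_of_isLink_of_isLink e x y v w h h' := by
    have h2 : s(x, y) = s(v, w) := h.symm.trans h'
    rcases Sym2.eq_iff.mp h2 with h3 | h3
    · exact Or.inl h3.1
    · exact Or.inr h3.1
  edge_mem_iff_exists_isLink e := by
    induction h : ends e with
    | h x y => exact ⟨fun _ => ⟨x, y, rfl⟩, fun _ => Set.mem_univ e⟩
  left_mem_of_isLink e x y _ := Set.mem_univ x

/-- Take a cycle of length `n` (for `n ≥ 2`) with vertices `0, …, n - 1` and `n` disjoint copies
of `H`, and identify the `i`-th vertex of the cycle with the copy of `u` in the `i`-th copy of `H`.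
The vertex `(i, x)` is the vertex `x` of the `i`-th copy of `H`, so that `(i, u)` is also the `i`-th
vertex of the cycle. The edge `inl (i, e)` is the edge `e` of the `i`-th copy of `H`, and `inr i` is
the edge of the cycle between its vertices `i` and `i + 1`. -/
def attachToCycle {α β : Type*} (H : Graph α β) (u : α) (hu : u ∈ H.vertexSet) (n : ℕ) :
    Graph (ZMod n × α) ((ZMod n × β) ⊕ ZMod n) where
  vertexSet := {p | p.2 ∈ H.vertexSet}
  edgeSet := {d | ∀ p, d = Sum.inl p → p.2 ∈ H.edgeSet}
  IsLink d p q := match d with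
    | Sum.inl (i, e) => p.1 = i ∧ q.1 = i ∧ H.IsLink e p.2 q.2
    | Sum.inr i => (p = (i, u) ∧ q = (i + 1, u)) ∨ (p = (i + 1, u) ∧ q = (i, u))
  isLink_symm := by
    rintro (⟨i, e⟩ | i) _
    · exact ⟨fun p q h => ⟨h.2.1, h.1, h.2.2.symm⟩⟩
    · exact ⟨fun p q h => h.elim (fun h => Or.inr ⟨h.2, h.1⟩) (fun h => Or.inl ⟨h.2, h.1⟩)⟩
  eq_or_eq_of_isLink_of_isLink := by
    rintro (⟨i, e⟩ | i) p q v w h h'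
    · rcases h.2.2.left_eq_or_eq h'.2.2 with h3 | h3
      · exact Or.inl (Prod.ext (h.1.trans h'.1.symm) h3)
      · exact Or.inr (Prod.ext (h.1.trans h'.2.1.symm) h3)
    · rcases h with h | h <;> rcases h' with h' | h'
      · exact Or.inl (h.1.trans h'.1.symm)
      · exact Or.inr (h.1.trans h'.2.symm)
      · exact Or.inr (h.1.trans h'.2.symm)
      · exact Or.inl (h.1.trans h'.1.symm)
  edge_mem_iff_exists_isLink := by
    rintro (⟨i, e⟩ | i)
    · constructor
      · intro h
        obtain ⟨x, y, hxy⟩ := H.exists_isLink_of_mem_edgeSet (h (i, e) rfl)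
        exact ⟨(i, x), (i, y), rfl, rfl, hxy⟩
      · rintro ⟨p, q, h⟩ p' hp'
        cases hp'
        exact h.2.2.edge_mem
    · exact ⟨fun _ => ⟨(i, u), (i + 1, u), Or.inl ⟨rfl, rfl⟩⟩, fun _ p hp => by cases hp⟩
  left_mem_of_isLink := by
    rintro (⟨i, e⟩ | i) p q h
    · exact h.2.2.left_mem
    · rcases h with h | h
      · rw [h.1]; exact hu
      · rw [h.1]; exact hu

/-- The multigraph on `10` vertices with `23` edges whose sparse6 code consists of the characters
`:Ig?COaaGS?aEQ?QDL?PAe`. -/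
def baseMultigraph : Graph (Fin 10) (Fin 23) :=
  ofEnds ![s(0, 4), s(0, 4), s(1, 5), s(1, 5), s(2, 5), s(1, 6), s(2, 6), s(2, 6),
    s(0, 7), s(1, 7), s(2, 7), s(3, 7), s(4, 7), s(0, 8), s(1, 8), s(4, 8), s(5, 8), s(6, 8),
    s(0, 9), s(2, 9), s(4, 9), s(5, 9), s(6, 9)]

/-- The multigraph obtained from a cycle of length `2 * k` and `2 * k` copies of `baseMultigraph`
by identifying every vertex of the cycle with the vertex `3` of one of the copies. -/
def cycleMultigraph (k : ℕ) :
    Graph (ZMod (2 * k) × Fin 10) ((ZMod (2 * k) × Fin 23) ⊕ ZMod (2 * k)) :=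
  attachToCycle baseMultigraph 3 (Set.mem_univ 3) (2 * k)

end Graph

/-! The upper bounds are explicit colourings by integers modulo 23 with distances at least 4. In the
cycle of copies the edge of each copy at its vertex 3 has colour 0, so the edges of the even cycle
can alternate between 8 and 16. Criticality comes from a 17/3-colouring for each deleted edge
(`deletedColoring`). Each cycle multigraph contains a copy of `baseMultigraph`, so everything rests
on the lower bound for the latter.

For that bound, suppose that r < 23/4. In a closed walk through conflicting edges, n steps with b
falls of the colour satisfy n ≤ r b. As 3·23 - 4·17 = 1, a fraction strictly between 17/3 and 23/4
has numerator at least 17 + 23 = 40. Hence n/b ≤ 17/3 on every cycle through at most 23 edges, and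
maximal path weights define a 17/3-colouring (`exists_int_coloring`).

No such colouring exists (`IsModColoring.false`): automorphisms normalise it, and a search over the
orders of conflicting edges refutes it. A node of the search is a matrix of lower bounds for colour
differences. The matrix is packed into one natural number, so that the kernel updates it with a few
operations on large numbers. Only soundness (`refute_sound`) is proved; the choice of branches is
unconstrained. -/

/-! ### Matrices of bytes packed into natural numbers. -/

/-- The number with the `n` digits `f 0, …, f (n - 1)` in base `b`. -/
def digitPack (b : ℕ) (f : ℕ → ℕ) : ℕ → ℕ
  | 0 => 0
  | n + 1 => digitPack b f n + f n * b ^ n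

theorem digitPack_congr {b n : ℕ} {f g : ℕ → ℕ} (h : ∀ i < n, f i = g i) :
    digitPack b f n = digitPack b g n := by
  induction n with
  | zero => rfl
  | succ n ih =>
    rw [digitPack, digitPack, ih fun i hi => h i (hi.trans n.lt_succ_self), h n n.lt_succ_self]

theorem digitPack_add (b n : ℕ) (f g : ℕ → ℕ) :
    digitPack b f n + digitPack b g n = digitPack b (fun i => f i + g i) n := by
  induction n with
  | zero => rfl
  | succ n ih => simp only [digitPack, ← ih]; ring

theorem digitPack_mul (b n k : ℕ) (f : ℕ → ℕ) :
    digitPack b f n * k = digitPack b (fun i => f i * k) n := by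
  induction n with
  | zero => simp [digitPack]
  | succ n ih => simp only [digitPack, ← ih]; ring

theorem digitPack_lt {w n : ℕ} {f : ℕ → ℕ} (h : ∀ i < n, f i < 2 ^ w) :
    digitPack (2 ^ w) f n < 2 ^ (w * n) := by
  induction n with
  | zero => simp [digitPack]
  | succ n ih =>
    have h1 := ih fun i hi => h i (hi.trans n.lt_succ_self)
    have h2 : (f n + 1) * (2 ^ w) ^ n ≤ 2 ^ w * (2 ^ w) ^ n :=
      Nat.mul_le_mul_right _ (h n n.lt_succ_self)
    rw [digitPack, Nat.mul_succ, pow_add, pow_mul]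
    rw [pow_mul] at h1
    nlinarith

/-- Digits below `2 ^ w` occupy disjoint blocks of `w` bits. This reduces masks and shifts of packed
matrices to a comparison of bits. -/
theorem testBit_digitPack {w n : ℕ} (hw : 0 < w) {f : ℕ → ℕ} (h : ∀ i < n, f i < 2 ^ w) (p : ℕ) :
    (digitPack (2 ^ w) f n).testBit p = (decide (p / w < n) && (f (p / w)).testBit (p % w)) := by
  induction n with
  | zero => simp [digitPack]
  | succ n ih =>
    have h1 := digitPack_lt fun i hi => h i (Nat.lt_trans hi n.lt_succ_self)
    rw [digitPack, ← pow_mul, add_comm, mul_comm (f n), Nat.testBit_two_pow_mul_add _ h1,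
      ih fun i hi => h i (hi.trans n.lt_succ_self)]
    have hp := Nat.div_add_mod p w
    have hm := Nat.mod_lt p hw
    split_ifs with hlt
    · have : p / w < n := Nat.div_lt_of_lt_mul hlt
      simp [this, this.trans n.lt_succ_self]
    · have hn : n ≤ p / w := (Nat.le_div_iff_mul_le hw).2 (by rw [mul_comm]; omega)
      rcases hn.eq_or_lt with rfl | hn'
      · have : p - w * (p / w) = p % w := by omega
        simp [this]
      · have : w ≤ p - w * n := by
          have := Nat.mul_le_mul_left w (Nat.succ_le_of_lt hn')
          rw [Nat.mul_succ] at this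
          omega
        have h2 : (f n).testBit (p - w * n) = false :=
          Nat.testBit_lt_two_pow ((h n n.lt_succ_self).trans_le (Nat.pow_le_pow_right two_pos this))
        rw [h2]
        simp; omega

/-- A `23 × 23` matrix of bytes, packed into one number. -/
def byteMatrix (d : ℕ → ℕ → ℕ) : ℕ :=
  digitPack (256 ^ 23) (fun i => digitPack 256 (d i) 23) 23

theorem byteMatrix_congr {d d' : ℕ → ℕ → ℕ} (h : ∀ i < 23, ∀ j < 23, d i j = d' i j) :
    byteMatrix d = byteMatrix d' :=
  digitPack_congr fun i hi => digitPack_congr (h i hi)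

theorem byteMatrix_add (d d' : ℕ → ℕ → ℕ) :
    byteMatrix d + byteMatrix d' = byteMatrix fun i j => d i j + d' i j := by
  simp only [byteMatrix, digitPack_add]

theorem byteMatrix_mul (d : ℕ → ℕ → ℕ) (k : ℕ) :
    byteMatrix d * k = byteMatrix fun i j => d i j * k := by
  simp only [byteMatrix, digitPack_mul]

theorem byteMatrix_sub {d d' : ℕ → ℕ → ℕ} (h : ∀ i < 23, ∀ j < 23, d' i j ≤ d i j) :
    byteMatrix d - byteMatrix d' = byteMatrix fun i j => d i j - d' i j := by
  rw [Nat.sub_eq_iff_eq_add', byteMatrix_add]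
  · exact byteMatrix_congr fun i hi j hj => (Nat.add_sub_cancel' (h i hi j hj)).symm
  · have : byteMatrix d = byteMatrix d' + byteMatrix fun i j => d i j - d' i j := by
      rw [byteMatrix_add]
      exact byteMatrix_congr fun i hi j hj => (Nat.add_sub_cancel' (h i hi j hj)).symm
    omega

theorem testBit_byteMatrix {d : ℕ → ℕ → ℕ} (h : ∀ i < 23, ∀ j < 23, d i j < 256) (p : ℕ) :
    (byteMatrix d).testBit p =
      (decide (p / 184 < 23) && (d (p / 184) (p % 184 / 8)).testBit (p % 8)) := by
  have h1 : ∀ i < 23, digitPack 256 (d i) 23 < 2 ^ 184 := fun i hi =>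
    digitPack_lt (w := 8) (h i hi)
  have e : (256 : ℕ) ^ 23 = 2 ^ 184 := by norm_num
  rw [byteMatrix, e, testBit_digitPack (by norm_num) h1]
  by_cases hp : p / 184 < 23
  · have h2 := testBit_digitPack (w := 8) (by norm_num) (h _ hp) (p % 184)
    norm_num at h2
    rw [h2]
    have h3 : p % 184 / 8 < 23 := by omega
    simp [hp, h3]
  · simp [hp]

/-! ### Entrywise operations on packed matrices. -/

/-- The value `k x`, arranged so that reducing it first evaluates `x` to a numeral. -/
noncomputable def evalThen {α : Type} (x : ℕ) (k : ℕ → α) : α :=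
  Nat.rec (k 0) (fun n _ => k (Nat.succ n)) x

theorem evalThen_eq {α : Type} (x : ℕ) (k : ℕ → α) : evalThen x k = k x := by
  cases x <;> rfl

def unitRow : ℕ := digitPack 256 (fun _ => 1) 23

def unitColumn : ℕ := digitPack (256 ^ 23) (fun _ => 1) 23

def unitMatrix : ℕ := byteMatrix fun _ _ => 1

def rowMask : ℕ := 256 ^ 23 - 1

def columnMask : ℕ := digitPack (256 ^ 23) (fun _ => 255) 23

/-- The entry `(a, b)` of a packed matrix. -/
def matrixEntry (D a b : ℕ) : ℕ :=
  Nat.land (Nat.shiftRight D (Nat.add (Nat.mul 184 a) (Nat.mul 8 b))) 255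

/-- The matrix with entries `D i a + D b j`. -/
def outerSum (D a b : ℕ) : ℕ :=
  Nat.add (Nat.mul (Nat.land (Nat.shiftRight D (Nat.mul 8 a)) columnMask) unitRow)
    (Nat.mul (Nat.land (Nat.shiftRight D (Nat.mul 184 b)) rowMask) unitColumn)

/-- The entrywise maximum of two packed matrices whose entries differ by at most `128`. -/
def entrywiseMax (X Y : ℕ) : ℕ :=
  Nat.xor X (Nat.land (Nat.xor X Y) (Nat.mul (Nat.land unitMatrix
    (Nat.shiftRight (Nat.sub (Nat.add Y (Nat.mul unitMatrix 128)) X) 7)) 255))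

/-- The closure of the system of lower bounds `D` after adding the inequality
`c a + 3 ≤ c b`. -/
def addPrecedence (D a b : ℕ) : ℕ :=
  Nat.sub (entrywiseMax (outerSum D a b) (Nat.add D (Nat.mul unitMatrix 29)))
    (Nat.mul unitMatrix 29)

theorem matrixEntry_byteMatrix {d : ℕ → ℕ → ℕ} (h : ∀ i < 23, ∀ j < 23, d i j < 256) {a b : ℕ}
    (hb : b < 23) : matrixEntry (byteMatrix d) a b = if a < 23 then d a b else 0 := by
  refine Nat.eq_of_testBit_eq fun p => ?_
  change ((byteMatrix d >>> (184 * a + 8 * b)) &&& (2 ^ 8 - 1)).testBit p = _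
  rw [Nat.testBit_and, Nat.testBit_shiftRight, testBit_byteMatrix h, Nat.testBit_two_pow_sub_one]
  by_cases hp : p < 8
  · have h1 : (184 * a + 8 * b + p) / 184 = a := by omega
    have h2 : (184 * a + 8 * b + p) % 184 / 8 = b := by omega
    have h3 : (184 * a + 8 * b + p) % 8 = p := by omega
    rw [h1, h2, h3]
    by_cases ha : a < 23 <;> simp [ha, hp]
  · by_cases ha : a < 23
    · have : (d a b).testBit p = false :=
        Nat.testBit_lt_two_pow ((h a ha b hb).trans_le
          (Nat.pow_le_pow_right (n := 2) (i := 8) two_pos (by omega)))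
      simp [ha, hp, this]
    · simp [ha, hp]

theorem column_byteMatrix {d : ℕ → ℕ → ℕ} (h : ∀ i < 23, ∀ j < 23, d i j < 256) {a : ℕ}
    (ha : a < 23) : (byteMatrix d >>> (8 * a)) &&& columnMask =
      digitPack (256 ^ 23) (fun i => d i a) 23 := by
  have e : (256 : ℕ) ^ 23 = 2 ^ 184 := by norm_num
  have hlt : ∀ x < 256, x < 2 ^ 184 := fun x hx => hx.trans (by norm_num)
  refine Nat.eq_of_testBit_eq fun p => ?_
  rw [Nat.testBit_and, Nat.testBit_shiftRight, testBit_byteMatrix h, columnMask, e,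
    testBit_digitPack (by norm_num) fun _ _ => hlt 255 (by norm_num),
    testBit_digitPack (by norm_num) fun i hi => hlt _ (h i hi a ha)]
  rw [show (255 : ℕ) = 2 ^ 8 - 1 from rfl, Nat.testBit_two_pow_sub_one]
  by_cases hp : p % 184 < 8
  · have h1 : (8 * a + p) / 184 = p / 184 := by omega
    have h2 : (8 * a + p) % 184 / 8 = a := by omega
    have h3 : (8 * a + p) % 8 = p % 184 := by omega
    rw [h1, h2, h3]
    by_cases hq : p / 184 < 23 <;> simp [hq, hp]
  · by_cases hq : p / 184 < 23
    · have : (d (p / 184) a).testBit (p % 184) = false :=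
        Nat.testBit_lt_two_pow ((h _ hq a ha).trans_le
          (Nat.pow_le_pow_right (n := 2) (i := 8) two_pos (by omega)))
      simp [hp, this]
    · simp [hp, hq]

theorem row_byteMatrix {d : ℕ → ℕ → ℕ} (h : ∀ i < 23, ∀ j < 23, d i j < 256) {b : ℕ}
    (hb : b < 23) : (byteMatrix d >>> (184 * b)) &&& rowMask = digitPack 256 (d b) 23 := by
  refine Nat.eq_of_testBit_eq fun p => ?_
  rw [show rowMask = 2 ^ 184 - 1 by norm_num [rowMask], Nat.testBit_and, Nat.testBit_shiftRight,
    testBit_byteMatrix h, Nat.testBit_two_pow_sub_one]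
  have h0 := testBit_digitPack (w := 8) (by norm_num) (h b hb) p
  norm_num at h0
  rw [h0]
  by_cases hp : p < 184
  · have h1 : (184 * b + p) / 184 = b := by omega
    have h2 : (184 * b + p) % 184 / 8 = p / 8 := by omega
    have h3 : (184 * b + p) % 8 = p % 8 := by omega
    have h4 : p / 8 < 23 := by omega
    rw [h1, h2, h3]
    simp [h4, hp, hb]
  · have h4 : ¬ p / 8 < 23 := by omega
    simp [hp, h4]

/-- Multiplying the isolated column by a row of ones copies each of its entries along a row;
multiplying the isolated row by a column of ones copies it into every row. -/
theorem outerSum_byteMatrix {d : ℕ → ℕ → ℕ} (h : ∀ i < 23, ∀ j < 23, d i j < 256) {a b : ℕ}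
    (ha : a < 23) (hb : b < 23) :
    outerSum (byteMatrix d) a b = byteMatrix fun i j => d i a + d b j := by
  change (byteMatrix d >>> (8 * a) &&& columnMask) * unitRow +
    (byteMatrix d >>> (184 * b) &&& rowMask) * unitColumn = _
  rw [column_byteMatrix h ha, row_byteMatrix h hb, unitColumn, mul_comm _ (digitPack _ _ _),
    digitPack_mul, digitPack_mul, digitPack_add, byteMatrix]
  refine digitPack_congr fun i _ => ?_
  rw [unitRow, mul_comm, digitPack_mul, one_mul]
  simp only [one_mul]
  exact digitPack_add _ _ _ _

theorem unitMatrix_mul (k : ℕ) : unitMatrix * k = byteMatrix fun _ _ => k := by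
  rw [unitMatrix, byteMatrix_mul]
  simp only [one_mul]

/-- Bit 7 of the byte `y + 128 - x` tells whether `x ≤ y`. Multiplied by 255 it becomes a mask of
the whole byte, and the exclusive or then selects `y` or `x`. -/
theorem entrywiseMax_byteMatrix {x y : ℕ → ℕ → ℕ} (hx : ∀ i < 23, ∀ j < 23, x i j ≤ y i j + 128)
    (hy : ∀ i < 23, ∀ j < 23, y i j + 128 - x i j < 256)
    (hx' : ∀ i < 23, ∀ j < 23, x i j < 256) (hy' : ∀ i < 23, ∀ j < 23, y i j < 256) :
    entrywiseMax (byteMatrix x) (byteMatrix y) = byteMatrix fun i j => max (x i j) (y i j) := by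
  change byteMatrix x ^^^ ((byteMatrix x ^^^ byteMatrix y) &&& ((unitMatrix &&&
    ((byteMatrix y + unitMatrix * 128 - byteMatrix x) >>> 7)) * 255)) = _
  rw [unitMatrix_mul, byteMatrix_add, byteMatrix_sub hx]
  have h1 : unitMatrix &&& (byteMatrix (fun i j => y i j + 128 - x i j) >>> 7) =
      byteMatrix fun i j => if x i j ≤ y i j then 1 else 0 := by
    refine Nat.eq_of_testBit_eq fun p => ?_
    rw [Nat.testBit_and, Nat.testBit_shiftRight, testBit_byteMatrix hy, unitMatrix,
      testBit_byteMatrix fun _ _ _ _ => by norm_num,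
      testBit_byteMatrix fun _ _ _ _ => by split_ifs <;> norm_num]
    by_cases hp : p / 184 < 23
    · by_cases h8 : p % 8 = 0
      · have e1 : (7 + p) / 184 = p / 184 := by omega
        have e2 : (7 + p) % 184 / 8 = p % 184 / 8 := by omega
        have e3 : (7 + p) % 8 = 7 := by omega
        have hj : p % 184 / 8 < 23 := by omega
        have hlt := hy _ hp _ hj
        rw [e1, e2, e3, h8]
        generalize x (p / 184) (p % 184 / 8) = u at *
        generalize y (p / 184) (p % 184 / 8) = v at *
        have key : ∀ w < 256, w.testBit 7 = decide (128 ≤ w) := fun w hw => by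
          rw [Nat.testBit_eq_decide_div_mod_eq]
          exact decide_eq_decide.2 (by omega)
        rw [key _ hlt]
        by_cases huv : u ≤ v
        · have : 128 ≤ v + 128 - u := by omega
          simp [huv, hp, this]
        · have : ¬ 128 ≤ v + 128 - u := by omega
          simp [huv, this]
      · have : ∀ k ≤ 1, k.testBit (p % 8) = false := fun k hk =>
          Nat.testBit_lt_two_pow (hk.trans_lt (Nat.one_lt_two_pow h8))
        rw [this 1 le_rfl, this _ (by split_ifs <;> norm_num)]
        simp
    · simp [hp]
  rw [h1, byteMatrix_mul]
  refine Nat.eq_of_testBit_eq fun p => ?_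
  rw [Nat.testBit_xor, Nat.testBit_and, Nat.testBit_xor, testBit_byteMatrix hx',
    testBit_byteMatrix hy', testBit_byteMatrix fun _ _ _ _ => by split_ifs <;> norm_num,
    testBit_byteMatrix fun i hi j hj => max_lt (hx' i hi j hj) (hy' i hi j hj)]
  have h255 : (255 : ℕ).testBit (p % 8) = true := by
    rw [show (255 : ℕ) = 2 ^ 8 - 1 from rfl, Nat.testBit_two_pow_sub_one]
    simp [Nat.mod_lt]
  by_cases hp : p / 184 < 23
  · by_cases hxy : x (p / 184) (p % 184 / 8) ≤ y (p / 184) (p % 184 / 8)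
    · simp [hp, hxy, h255]
    · simp [hp, hxy, le_of_not_ge hxy]
  · simp [hp]

/-! ### Difference bounds and the search for a contradiction. -/

/-- The lower bounds `c j - c i ≥ d i j - 32` hold. -/
def HoldsFor (d : ℕ → ℕ → ℕ) (c : ℕ → ℕ) : Prop :=
  ∀ i < 23, ∀ j < 23, c i + d i j ≤ c j + 32

/-- With offset 32, chaining the bounds from `i` to `a`, from `a` to `b` (which is 3) and from `b`
to `j` gives the entry `d i a + d b j - 29`. Adding 29 to the old entries before taking the maximum
avoids truncated subtraction. Colours of at most 16 prevent overflow of the bytes. -/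
theorem addPrecedence_byteMatrix {d : ℕ → ℕ → ℕ} {c : ℕ → ℕ} (hd : HoldsFor d c)
    (hc : ∀ i < 23, c i ≤ 16) {a b : ℕ} (ha : a < 23) (hb : b < 23) (hab : c a + 3 ≤ c b) :
    ∃ d', addPrecedence (byteMatrix d) a b = byteMatrix d' ∧ HoldsFor d' c := by
  have hd48 : ∀ i < 23, ∀ j < 23, d i j ≤ 48 := fun i hi j hj => by
    have := hd i hi j hj
    have := hc j hj
    omega
  have key : ∀ i < 23, ∀ j < 23, c i + (d i a + d b j) + 3 ≤ c j + 64 := fun i hi j hj => by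
    have := hd i hi a ha
    have := hd b hb j hj
    omega
  refine ⟨fun i j => max (d i a + d b j) (d i j + 29) - 29, ?_, fun i hi j hj => ?_⟩
  · change entrywiseMax (outerSum (byteMatrix d) a b) (byteMatrix d + unitMatrix * 29) -
      unitMatrix * 29 = _
    rw [outerSum_byteMatrix (fun i hi j hj => (hd48 i hi j hj).trans_lt (by norm_num)) ha hb,
      unitMatrix_mul, byteMatrix_add, entrywiseMax_byteMatrix, byteMatrix_sub]
    · exact fun i _ j _ => le_max_of_le_right (Nat.le_add_left _ _)
    all_goals
      intro i hi j hj
      have := key i hi j hj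
      have := hc j hj
      have := hd48 i hi j hj
      omega
  · have := key i hi j hj
    have := hd i hi j hj
    change c i + (max (d i a + d b j) (d i j + 29) - 29) ≤ c j + 32
    omega

/-- The ends of the edges of `Graph.baseMultigraph`, in reverse order. -/
def reversedEnds : List (ℕ × ℕ) :=
  [(6, 9), (5, 9), (4, 9), (2, 9), (0, 9), (6, 8), (5, 8), (4, 8), (1, 8), (0, 8), (4, 7), (3, 7),
    (2, 7), (1, 7), (0, 7), (2, 6), (2, 6), (1, 6), (2, 5), (1, 5), (1, 5), (0, 4), (0, 4)]

/-- Two distinct edges, numbered in reverse order, have a common end. -/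
def conflict (e f : ℕ) : Bool :=
  let x := reversedEnds.getD e (0, 0)
  let y := reversedEnds.getD f (0, 0)
  e != f && (x.1 == y.1 || x.1 == y.2 || x.2 == y.1 || x.2 == y.2)

def conflictMatrix : ℕ := byteMatrix fun i j => bif conflict i j then 1 else 0

/-- The positions of the entries of a packed matrix that are at least `t`. -/
def atLeast (D t : ℕ) : ℕ :=
  Nat.land unitMatrix (Nat.shiftRight (Nat.add D (Nat.mul (Nat.sub 128 t) unitMatrix)) 7)

/-- The exponents `p` of the powers `256 ^ p`, looked up by their residues modulo `1063`. -/
def exponentTable : ℕ :=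
  Nat.rec 0 (fun p s => s + p * 1024 ^ (256 ^ p % 1063)) 529

/-- The position of the first nonzero entry of a packed matrix of zeros and ones. -/
def firstPosition (m : ℕ) : ℕ :=
  -- The lowest set bit of `m` is a power of 256; its residue modulo 1063 selects a cell of 10 bits
  -- in the table.
  Nat.land 1023 (Nat.shiftRight exponentTable
    (Nat.mul 10 (Nat.mod (Nat.sub m (Nat.land m (Nat.sub m 1))) 1063)))

def orElse (m n : ℕ) : ℕ := cond (Nat.beq m 0) n m

/-- The entries of `D` in the positions `U` that are maximal. -/
def maximalEntries (D U : ℕ) : ℕ :=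
  Nat.rec 0 (fun t m => orElse (Nat.land U (atLeast D t)) m) 30

/-- A conflicting pair to branch on: preferably one whose order is already forced by the bounds `D`,
else an undecided one with a maximal lower bound. -/
def branchPosition (D U : ℕ) : ℕ :=
  -- Entries from 30 to 34 are lower bounds from -2 to 2. For a conflicting pair they force a
  -- difference of at least 3, so that one of the two branches closes at once.
  firstPosition (orElse (Nat.land conflictMatrix (Nat.xor (atLeast D 30) (atLeast D 35)))
    (maximalEntries D (Nat.land U (Nat.xor unitMatrix (atLeast D 30)))))

def pairPositions (e f : ℕ) : ℕ :=
  Nat.lor (Nat.shiftLeft 1 (Nat.mul 8 (Nat.add (Nat.mul 23 e) f)))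
    (Nat.shiftLeft 1 (Nat.mul 8 (Nat.add (Nat.mul 23 f) e)))

/-- Continue with the bounds `D` and the additional inequality `c a + 3 ≤ c b`, unless they
contradict each other. -/
def refuteWith (D a b : ℕ) (k : ℕ → Bool) : Bool :=
  cond (Nat.ble 30 (matrixEntry D b a)) true (k (addPrecedence D a b))

/-- Search for a proof that there is no `c` that satisfies the bounds `D`, and in which any two
conflicting values differ by at least `3`. The pairs `V` have been branched on. -/
noncomputable def refute (fuel : ℕ) : ℕ → ℕ → Bool :=
  Nat.rec (fun _ _ => false) (fun _ ih D V =>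
    evalThen (branchPosition D (Nat.xor conflictMatrix V)) fun p =>
    evalThen (Nat.div p 23) fun e =>
    evalThen (Nat.mod p 23) fun f =>
    cond (Nat.beq 1 (matrixEntry conflictMatrix e f))
      (cond (refuteWith D e f fun D' => ih D' (Nat.lor V (pairPositions e f)))
        (refuteWith D f e fun D' => ih D' (Nat.lor V (pairPositions e f))) false) false) fuel

theorem refuteWith_sound {d : ℕ → ℕ → ℕ} {c : ℕ → ℕ} {k : ℕ → Bool} {a b : ℕ}
    (hk : ∀ d, HoldsFor d c → k (byteMatrix d) = false) (hc : ∀ i < 23, c i ≤ 16)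
    (hd : HoldsFor d c) (ha : a < 23) (hb : b < 23) (hab : c a + 3 ≤ c b) :
    refuteWith (byteMatrix d) a b k = false := by
  have hlt : ∀ i < 23, ∀ j < 23, d i j < 256 := fun i hi j hj => by
    have := hd i hi j hj
    have := hc j hj
    omega
  obtain ⟨d', h, hd'⟩ := addPrecedence_byteMatrix hd hc ha hb hab
  -- An entry of at least 30 would mean `c a - c b ≥ -2`, against `hab`.
  have h30 : Nat.ble 30 (matrixEntry (byteMatrix d) b a) = false := by
    rw [matrixEntry_byteMatrix hlt ha, if_pos hb, Bool.eq_false_iff, Ne, Nat.ble_eq]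
    have := hd b hb a ha
    omega
  rw [refuteWith, h30, h]
  exact hk d' hd'

theorem matrixEntry_conflictMatrix {e f : ℕ} (hf : f < 23) (h : 1 = matrixEntry conflictMatrix e f) :
    e < 23 ∧ conflict e f = true := by
  rw [conflictMatrix, matrixEntry_byteMatrix (fun _ _ _ _ => by cases conflict _ _ <;> simp) hf] at h
  split_ifs at h with he
  cases hc : conflict e f
  · simp [hc] at h
  · exact ⟨he, rfl⟩

/-- A solution `c` survives in one of the two branches for any conflicting pair, so the search
cannot succeed. The set `V` only guides the search and is therefore arbitrary. -/
theorem refute_sound {c : ℕ → ℕ} (hc : ∀ i < 23, c i ≤ 16)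
    (hconf : ∀ e < 23, ∀ f < 23, conflict e f = true → c e + 3 ≤ c f ∨ c f + 3 ≤ c e) (fuel : ℕ) :
    ∀ (V : ℕ) (d : ℕ → ℕ → ℕ), HoldsFor d c → refute fuel (byteMatrix d) V = false := by
  induction fuel with
  | zero => exact fun _ _ _ => rfl
  | succ fuel ih =>
    intro V d hd
    -- The origin of the position `p` is forgotten: the test against `conflictMatrix` provides all
    -- that is needed.
    obtain ⟨p, hp⟩ : ∃ p, refute (fuel + 1) (byteMatrix d) V =
        cond (Nat.beq 1 (matrixEntry conflictMatrix (p / 23) (p % 23))) (cond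
          (refuteWith (byteMatrix d) (p / 23) (p % 23) fun D' =>
            refute fuel D' (Nat.lor V (pairPositions (p / 23) (p % 23))))
          (refuteWith (byteMatrix d) (p % 23) (p / 23) fun D' =>
            refute fuel D' (Nat.lor V (pairPositions (p / 23) (p % 23)))) false) false :=
      ⟨branchPosition (byteMatrix d) (Nat.xor conflictMatrix V), by
        simp only [refute, evalThen_eq]
        rfl⟩
    have hf : p % 23 < 23 := Nat.mod_lt _ (by norm_num)
    rw [hp]
    cases hb : Nat.beq 1 (matrixEntry conflictMatrix (p / 23) (p % 23)) with
    | false => rfl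
    | true =>
      obtain ⟨he, hef⟩ := matrixEntry_conflictMatrix hf (Nat.eq_of_beq_eq_true hb)
      rcases hconf _ he _ hf hef with h | h
      · rw [refuteWith_sound (fun d' hd' => ih _ d' hd') hc hd he hf h]
        rfl
      · rw [refuteWith_sound (fun d' hd' => ih _ d' hd') hc hd hf he h]
        cases refuteWith _ _ _ _ <;> rfl

/-! ### Nonexistence of a 17/3-colouring. -/

/-- Lower bounds for a colouring with colours at most `16` in which the edges `22` and `21` have the
colours `0` and at most `8`. -/
def initialBounds (i j : ℕ) : ℕ :=
  bif i == j || i == 22 then 32 else bif i == 21 then 24 else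
    bif conflict 22 i || conflict i j then 18 else 16

/-- The four initial orders are those that the automorphisms permit. Insufficient fuel could only
produce `false`. -/
noncomputable def refutation : Bool :=
  refuteWith (byteMatrix initialBounds) 20 19 fun D =>
  refuteWith D 16 15 fun D =>
  refuteWith D 14 10 fun D =>
  refuteWith D 9 4 fun D =>
  refute 80 D (Nat.lor (Nat.lor (pairPositions 20 19) (pairPositions 16 15))
    (Nat.lor (pairPositions 14 10) (pairPositions 9 4)))

set_option maxRecDepth 100000 in
theorem refutation_eq_true : refutation = true := by
  decide +kernel

theorem conflict_comm : ∀ e < 23, ∀ f < 23, conflict e f = conflict f e := by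
  decide

/-- The entries 24, 18 and 16 encode the bounds -8, -14 and -16. A neighbour of the edge 22 has
colour at most 14 because that edge has colour 0. -/
theorem initialBounds_holdsFor {c : ℕ → ℕ} (hc : ∀ i < 23, c i ≤ 16)
    (hconf : ∀ e < 23, ∀ f < 23, conflict e f = true → c f ≤ c e + 14)
    (h22 : c 22 = 0) (h21 : c 21 ≤ 8) : HoldsFor initialBounds c := by
  intro i hi j hj
  have h1 := hc i hi
  have h2 := hc j hj
  unfold initialBounds
  rcases Decidable.em (i = j) with rfl | hij
  · simp
  rcases Decidable.em (i = 22) with rfl | hi22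
  · simp [h22]
  rcases Decidable.em (i = 21) with rfl | hi21
  · simp [beq_eq_false_iff_ne.2 hij, beq_eq_false_iff_ne.2 hi22]; omega
  simp only [beq_eq_false_iff_ne.2 hij, beq_eq_false_iff_ne.2 hi22, beq_eq_false_iff_ne.2 hi21,
    Bool.false_or, cond_false]
  cases h : conflict 22 i
  · cases h' : conflict i j
    · simp; omega
    · have := hconf j hj i hi (conflict_comm i hi j hj ▸ h')
      simp; omega
  · have := hconf 22 (by norm_num) i hi h
    simp; omega

theorem no_normalised_coloring {c : ℕ → ℕ} (hc : ∀ i < 23, c i ≤ 16)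
    (hconf : ∀ e < 23, ∀ f < 23, conflict e f = true →
      (c e + 3 ≤ c f ∨ c f + 3 ≤ c e) ∧ c f ≤ c e + 14)
    (h22 : c 22 = 0) (h21 : c 21 ≤ 8) (h1 : c 20 + 3 ≤ c 19) (h2 : c 16 + 3 ≤ c 15)
    (h3 : c 14 + 3 ≤ c 10) (h4 : c 9 + 3 ≤ c 4) : False := by
  have h : refutation = false := by
    refine refuteWith_sound (fun d hd => ?_) hc (initialBounds_holdsFor hc
      (fun e he f hf hef => (hconf e he f hf hef).2) h22 h21) (by norm_num) (by norm_num) h1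
    refine refuteWith_sound (fun d hd => ?_) hc hd (by norm_num) (by norm_num) h2
    refine refuteWith_sound (fun d hd => ?_) hc hd (by norm_num) (by norm_num) h3
    refine refuteWith_sound (fun d hd => ?_) hc hd (by norm_num) (by norm_num) h4
    exact refute_sound hc (fun e he f hf hef => (hconf e he f hf hef).1) _ _ _ hd
  rw [refutation_eq_true] at h
  exact Bool.noConfusion h

/-- `c` is a colouring of the edges of `Graph.baseMultigraph`, numbered in reverse order, by the
integers modulo `17` in which the colours of conflicting edges have distance at least `3`. -/
def IsModColoring (c : Fin 23 → ℤ) : Prop :=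
  ∀ e f : Fin 23, conflict e f = true → 3 ≤ (c f - c e) % 17 ∧ (c f - c e) % 17 ≤ 14

theorem IsModColoring.comp {c : Fin 23 → ℤ} (hc : IsModColoring c) (σ : Equiv.Perm (Fin 23))
    (hσ : ∀ e f : Fin 23, conflict e f = true → conflict (σ e) (σ f) = true) :
    IsModColoring fun e => c (σ e) :=
  fun e f h => hc _ _ (hσ e f h)

theorem IsModColoring.emod_ne {c : Fin 23 → ℤ} (hc : IsModColoring c) {e f : Fin 23}
    (h : conflict e f = true) : c e % 17 ≠ c f % 17 := by
  have := hc e f h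
  omega

/-- If the automorphism `σ` swaps two conflicting edges, one may assume that they are coloured
in increasing order. -/
theorem IsModColoring.exists_lt {c : Fin 23 → ℤ} (hc : IsModColoring c) (σ : Equiv.Perm (Fin 23))
    (hσ : ∀ e f : Fin 23, conflict e f = true → conflict (σ e) (σ f) = true) (a b : Fin 23)
    (hab : conflict a b = true) (hσa : σ a = b) (hσb : σ b = a) :
    ∃ c', IsModColoring c' ∧ c' a % 17 < c' b % 17 ∧ (c' = c ∨ c' = fun e => c (σ e)) := by
  rcases lt_or_gt_of_ne (hc.emod_ne hab) with h | h
  · exact ⟨c, hc, h, Or.inl rfl⟩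
  · exact ⟨_, hc.comp σ hσ, by simpa only [hσa, hσb] using h, Or.inr rfl⟩

/-- Each automorphism used below fixes the edges involved in the earlier normalisations, so these
persist. -/
theorem IsModColoring.false {c : Fin 23 → ℤ} (hc : IsModColoring c) : False := by
  obtain ⟨c₁, hc₁, h22, h21⟩ : ∃ c', IsModColoring c' ∧ c' 22 % 17 = 0 ∧ c' 21 % 17 ≤ 8 := by
    -- Rotation moves the colour of 22 to 0; a reflection, if necessary, brings that of the parallel
    -- edge 21 into the lower half.
    by_cases h : (c 21 - c 22) % 17 ≤ 8
    · exact ⟨fun e => c e - c 22, fun e f hef => by have := hc e f hef; dsimp only; omega,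
        by dsimp only; omega, h⟩
    · exact ⟨fun e => c 22 - c e, fun e f hef => by have := hc e f hef; dsimp only; omega,
        by dsimp only; omega, by dsimp only; omega⟩
  -- The exchange of the vertices 0 and 4.
  obtain ⟨c₂, hc₂, h14, h⟩ := hc₁.exists_lt
    (Equiv.swap 14 10 * Equiv.swap 9 7 * Equiv.swap 4 2) (by decide) 14 10
    (by decide) (by decide) (by decide)
  replace h22 : c₂ 22 % 17 = 0 := by rcases h with rfl | rfl <;> exact h22
  replace h21 : c₂ 21 % 17 ≤ 8 := by rcases h with rfl | rfl <;> exact h21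
  clear h hc₁ hc
  -- The simultaneous exchange of the vertices 1 and 2, 5 and 6, 8 and 9.
  obtain ⟨c₃, hc₃, h9, h⟩ := hc₂.exists_lt
    (Equiv.swap 20 16 * Equiv.swap 19 15 * Equiv.swap 18 17 * Equiv.swap 13 12 * Equiv.swap 8 3 *
      Equiv.swap 6 0 * Equiv.swap 5 1 * Equiv.swap 9 4 * Equiv.swap 7 2) (by decide) 9 4
    (by decide) (by decide) (by decide)
  replace h22 : c₃ 22 % 17 = 0 := by rcases h with rfl | rfl <;> exact h22
  replace h21 : c₃ 21 % 17 ≤ 8 := by rcases h with rfl | rfl <;> exact h21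
  replace h14 : c₃ 14 % 17 < c₃ 10 % 17 := by rcases h with rfl | rfl <;> exact h14
  clear h hc₂
  -- Here and in the next normalisation, two parallel edges are exchanged.
  obtain ⟨c₄, hc₄, h20, h⟩ := hc₃.exists_lt (Equiv.swap 20 19) (by decide) 20 19
    (by decide) (by decide) (by decide)
  replace h22 : c₄ 22 % 17 = 0 := by rcases h with rfl | rfl <;> exact h22
  replace h21 : c₄ 21 % 17 ≤ 8 := by rcases h with rfl | rfl <;> exact h21
  replace h14 : c₄ 14 % 17 < c₄ 10 % 17 := by rcases h with rfl | rfl <;> exact h14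
  replace h9 : c₄ 9 % 17 < c₄ 4 % 17 := by rcases h with rfl | rfl <;> exact h9
  clear h hc₃
  obtain ⟨c₅, hc₅, h16, h⟩ := hc₄.exists_lt (Equiv.swap 16 15) (by decide) 16 15
    (by decide) (by decide) (by decide)
  replace h22 : c₅ 22 % 17 = 0 := by rcases h with rfl | rfl <;> exact h22
  replace h21 : c₅ 21 % 17 ≤ 8 := by rcases h with rfl | rfl <;> exact h21
  replace h14 : c₅ 14 % 17 < c₅ 10 % 17 := by rcases h with rfl | rfl <;> exact h14
  replace h9 : c₅ 9 % 17 < c₅ 4 % 17 := by rcases h with rfl | rfl <;> exact h9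
  replace h20 : c₅ 20 % 17 < c₅ 19 % 17 := by rcases h with rfl | rfl <;> exact h20
  clear h hc₄
  have key : ∀ e f : Fin 23, conflict e f = true →
      ((c₅ e % 17).toNat + 3 ≤ (c₅ f % 17).toNat ∨ (c₅ f % 17).toNat + 3 ≤ (c₅ e % 17).toNat) ∧
        (c₅ f % 17).toNat ≤ (c₅ e % 17).toNat + 14 := fun e f hef => by
    have := hc₅ e f hef
    omega
  have hlt : ∀ a b : Fin 23, conflict a b = true → c₅ a % 17 < c₅ b % 17 →
      (c₅ a % 17).toNat + 3 ≤ (c₅ b % 17).toNat := fun a b hab h => by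
    have := key a b hab
    omega
  refine no_normalised_coloring (c := fun i => (c₅ (Fin.ofNat 23 i) % 17).toNat)
    (fun i _ => ?_) (fun e he f hf hef => ?_) ?_ ?_ (hlt 20 19 (by decide) h20)
    (hlt 16 15 (by decide) h16) (hlt 14 10 (by decide) h14) (hlt 9 4 (by decide) h9)
  · omega
  · refine key _ _ ?_
    simpa only [Fin.ofNat, Nat.mod_eq_of_lt he, Nat.mod_eq_of_lt hf] using hef
  · change (c₅ 22 % 17).toNat = 0
    omega
  · change (c₅ 21 % 17).toNat ≤ 8
    omega

/-! ### From circumference below 23/4 to circumference 17/3. -/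

/-- The weight of a walk: a rising step counts `3`, a falling step counts `-14`. Walks are listed
from their end to their start. -/
noncomputable def walkWeight {ι : Type*} (c : ι → ℝ) : List ι → ℤ
  | [] => 0
  | [_] => 0
  | f :: e :: l => (if c e < c f then 3 else -14) + walkWeight c (e :: l)

theorem walkWeight_append {ι : Type*} (c : ι → ℝ) (f : ι) (l' : List ι) : ∀ l : List ι,
    walkWeight c (l ++ f :: l') = walkWeight c (l ++ [f]) + walkWeight c (f :: l')
  | [] => by simp [walkWeight]
  | [a] => by simp [walkWeight]
  | a :: b :: l => by
    have := walkWeight_append c f l' (b :: l)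
    simp only [List.cons_append] at this ⊢
    rw [walkWeight, walkWeight, this, add_assoc]

/-- Here `b` counts the falling steps: a rising step changes `c` by at least 1, a falling one by at
least `1 - r`, and -14 = 3 - 17. -/
theorem exists_walkWeight_eq {ι : Type*} {c : ι → ℝ} {r : ℝ} {R : ι → ι → Prop}
    (hR : ∀ e f, R e f → 1 ≤ |c e - c f| ∧ |c e - c f| ≤ r - 1) (z : ι) : ∀ (l : List ι) (h : ι),
    List.IsChain R (h :: (l ++ [z])) → ∃ b : ℕ,
      walkWeight c (h :: (l ++ [z])) = 3 * (l.length + 1) - 17 * b ∧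
        ((l.length : ℝ) + 1) - r * b ≤ c h - c z
  | [], h, hl => by
    have hz := hR h z (by simpa using hl)
    by_cases hlt : c z < c h
    · refine ⟨0, by simp [walkWeight, hlt], ?_⟩
      rw [abs_of_pos (sub_pos.2 hlt)] at hz
      simpa using hz.1
    · refine ⟨1, by simp [walkWeight, hlt], ?_⟩
      rw [abs_of_nonpos (sub_nonpos.2 (not_lt.1 hlt))] at hz
      simp
      linarith [hz.2]
  | a :: l, h, hl => by
    rw [List.cons_append, List.isChain_cons_cons] at hl
    obtain ⟨b, hb, hb'⟩ := exists_walkWeight_eq hR z l a hl.2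
    have hz := hR h a hl.1
    by_cases hlt : c a < c h
    · refine ⟨b, ?_, ?_⟩
      · rw [List.cons_append, walkWeight, hb, if_pos hlt, List.length_cons]
        push_cast
        ring
      · rw [abs_of_pos (sub_pos.2 hlt)] at hz
        push_cast [List.length_cons]
        linarith [hz.1]
    · refine ⟨b + 1, ?_, ?_⟩
      · rw [List.cons_append, walkWeight, hb, if_neg hlt, List.length_cons]
        push_cast
        ring
      · rw [abs_of_nonpos (sub_nonpos.2 (not_lt.1 hlt))] at hz
        push_cast [List.length_cons]
        linarith [hz.2]

/-- A circular colouring of circumference less than `23 / 4` of at most `23` elements gives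
one of circumference `17 / 3`, scaled to integers. -/
theorem exists_int_coloring {ι : Type*} [Fintype ι] (hι : Fintype.card ι ≤ 23) {c : ι → ℝ} {r : ℝ}
    (hr : r < 23 / 4) {R : ι → ι → Prop} (hsymm : ∀ e f, R e f → R f e)
    (hR : ∀ e f, R e f → 1 ≤ |c e - c f| ∧ |c e - c f| ≤ r - 1) :
    ∃ d : ι → ℤ, ∀ e f, R e f → 3 ≤ |d e - d f| ∧ |d e - d f| ≤ 14 := by
  classical
  let paths : ι → Set (List ι) := fun f => {l | l.Nodup ∧ l.IsChain R ∧ l.head? = some f}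
  have hfin : ∀ f, (paths f).Finite := fun f =>
    (List.finite_length_le ι (Fintype.card ι)).subset fun l hl => hl.1.length_le_card
  have hmax : ∀ f, ∃ l ∈ paths f, ∀ l' ∈ paths f, walkWeight c l' ≤ walkWeight c l := fun f =>
    Set.exists_max_image _ _ (hfin f) ⟨[f], by simp, by simp, rfl⟩
  choose p hp hpmax using hmax
  have key : ∀ e f, R e f →
      walkWeight c (p e) + (if c e < c f then 3 else -14) ≤ walkWeight c (p f) := by
    intro e f hef
    obtain ⟨hnd, hch, hhd⟩ := hp e
    obtain ⟨l, hl⟩ : ∃ l, p e = e :: l := by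
      cases h : p e with
      | nil => simp [h] at hhd
      | cons a l => simp [h] at hhd; exact ⟨l, by rw [hhd]⟩
    -- If `f` lies on the optimal path to `e`, the path is cut there: one piece is a path to `f`,
    -- the other closes up to a cycle of nonpositive weight. Otherwise the path extends to `f`.
    by_cases hf : f ∈ p e
    · obtain ⟨l₁, l₂, h12⟩ := List.append_of_mem hf
      have hpath : f :: l₂ ∈ paths f := by
        refine ⟨?_, ?_, rfl⟩
        · rw [h12] at hnd
          exact (List.nodup_append.1 hnd).2.1
        · rw [h12] at hch
          exact (List.isChain_append.1 hch).2.1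
      have h2 := hpmax f _ hpath
      have hcyc : (if c e < c f then 3 else -14) + walkWeight c (l₁ ++ [f]) ≤ 0 := by
        have hfe : f ≠ e := by
          rintro rfl
          have := (hR f f hef).1
          simp at this
          linarith
        obtain ⟨l₁', rfl⟩ : ∃ l₁', l₁ = e :: l₁' := by
          cases l₁ with
          | nil => rw [hl] at h12; simp at h12; exact absurd h12.1.symm hfe
          | cons a l₁' => rw [hl] at h12; simp at h12; exact ⟨l₁', by rw [h12.1]⟩
        have hchain : List.IsChain R (f :: ((e :: l₁') ++ [f])) := by
          rw [List.cons_append, List.isChain_cons_cons]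
          refine ⟨hsymm e f hef, ?_⟩
          have : p e = (e :: l₁' ++ [f]) ++ l₂ := by rw [h12]; simp
          rw [this] at hch
          exact (List.isChain_append.1 hch).1
        obtain ⟨b, hb, hb'⟩ := exists_walkWeight_eq hR f _ _ hchain
        have hlen : (e :: l₁').length + 1 ≤ 23 := by
          have h3 := hnd.length_le_card
          rw [h12] at h3
          simp only [List.length_append, List.length_cons] at h3 ⊢
          omega
        have hb4 : 4 * ((e :: l₁').length + 1) < 23 * b := by
          rw [sub_self] at hb'
          have h5 : (0 : ℝ) < (e :: l₁').length + 1 := by positivity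
          have h6 : (0 : ℝ) < b := by
            rcases Nat.eq_zero_or_pos b with rfl | h
            · simp at hb' h5
              linarith
            · exact_mod_cast h
          have : (4 : ℝ) * ((e :: l₁').length + 1) < 23 * b := by nlinarith
          exact_mod_cast this
        have hw : walkWeight c (f :: ((e :: l₁') ++ [f])) =
          (if c e < c f then 3 else -14) + walkWeight c (e :: l₁' ++ [f]) := by
          rw [List.cons_append, walkWeight]
        rw [← hw, hb]
        -- With n ≤ 23 steps, 4n < 23b implies 3n ≤ 17b: otherwise b ≥ 7, and then n ≥ 40.
        omega
      rw [h12, walkWeight_append]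
      linarith
    · have h2 := hpmax f (f :: p e) ⟨List.nodup_cons.2 ⟨hf, hnd⟩, by
        rw [hl] at hch ⊢
        exact List.isChain_cons_cons.2 ⟨hsymm e f hef, hch⟩, rfl⟩
      rw [hl, walkWeight] at h2
      rw [hl]
      linarith
  -- By `key` in both directions, this potential increases by at least 3 and at most 14 along every
  -- rising step.
  refine ⟨fun e => walkWeight c (p e), fun e f hef => ?_⟩
  have h1 := key e f hef
  have h2 := key f e (hsymm e f hef)
  dsimp only
  have hne : c e ≠ c f := by
    intro h
    have := (hR e f hef).1
    simp [h] at this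
    linarith
  rcases lt_or_gt_of_ne hne with h | h
  · rw [if_pos h] at h1
    rw [if_neg h.not_gt] at h2
    rw [abs_sub_comm, abs_of_nonneg] <;> omega
  · rw [if_neg h.not_gt] at h1
    rw [if_pos h] at h2
    rw [abs_of_nonneg] <;> omega

/-! ### The index and the criticality of the building block. -/

namespace Graph

variable {α β : Type*} {G : Graph α β}

theorem circularChromaticIndex_le {r : ℝ} (hr : 1 ≤ r) {c : β → ℝ}
    (hc : G.IsCircularEdgeColoring r c) : G.circularChromaticIndex ≤ r :=
  csInf_le ⟨1, fun _ h => h.1⟩ ⟨hr, c, hc⟩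

/-- Natural numbers below `p` such that the colours of edges with a common end differ by at least
`q` modulo `p` give a circular `p / q`-edge-colouring. -/
theorem isCircularEdgeColoring_div {p q : ℕ} (hq : 0 < q) {c : β → ℕ}
    (hloop : ∀ e x, ¬ G.IsLoopAt e x) (hlt : ∀ e ∈ G.edgeSet, c e < p)
    (hdist : ∀ e f x, e ≠ f → G.Inc e x → G.Inc f x →
      (c e + q ≤ c f ∨ c f + q ≤ c e) ∧ c f + q ≤ c e + p) :
    G.IsCircularEdgeColoring (p / q) fun e => c e / q where
  not_isLoopAt := hloop
  mem_Ico e he := by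
    have hq' : (0 : ℝ) < q := by exact_mod_cast hq
    have : (c e : ℝ) < p := by exact_mod_cast hlt e he
    exact ⟨by positivity, by gcongr⟩
  dist e f x hef he hf := by
    have hq' : (0 : ℝ) < q := by exact_mod_cast hq
    obtain ⟨h₁, h₂⟩ := hdist e f x hef he hf
    have h₃ := (hdist f e x hef.symm hf he).2
    have h₂' : (c f : ℝ) + q ≤ c e + p := by exact_mod_cast h₂
    have h₃' : (c e : ℝ) + q ≤ c f + p := by exact_mod_cast h₃
    have key : (q : ℝ) ≤ |(c e : ℝ) - c f| := by
      rcases h₁ with h | h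
      · have h' : (c e : ℝ) + q ≤ c f := by exact_mod_cast h
        exact le_abs.2 (Or.inr (by linarith))
      · have h' : (c f : ℝ) + q ≤ c e := by exact_mod_cast h
        exact le_abs.2 (Or.inl (by linarith))
    have key' : |(c e : ℝ) - c f| ≤ p - q := abs_le.2 ⟨by linarith, by linarith⟩
    rw [← sub_div, abs_div, abs_of_pos hq', one_le_div hq', div_le_iff₀ hq', sub_mul,
      div_mul_cancel₀ _ hq'.ne', one_mul]
    exact ⟨key, key'⟩

/-- The ends of the edge `e` of `baseMultigraph`. -/
def baseEnds (e : Fin 23) : Fin 10 × Fin 10 :=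
  let p := reversedEnds.getD e.rev (0, 0)
  (Fin.ofNat 10 p.1, Fin.ofNat 10 p.2)

theorem baseMultigraph_isLink {e : Fin 23} {x y : Fin 10} :
    baseMultigraph.IsLink e x y ↔ s((baseEnds e).1, (baseEnds e).2) = s(x, y) := by
  have h : ∀ e : Fin 23, ![s(0, 4), s(0, 4), s(1, 5), s(1, 5), s(2, 5), s(1, 6), s(2, 6), s(2, 6),
      s(0, 7), s(1, 7), s(2, 7), s(3, 7), s(4, 7), s(0, 8), s(1, 8), s(4, 8), s(5, 8), s(6, 8),
      s(0, 9), s(2, 9), s(4, 9), s(5, 9), s((6 : Fin 10), (9 : Fin 10))] e =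
      s((baseEnds e).1, (baseEnds e).2) := by decide +kernel
  rw [← h e]
  rfl

theorem baseMultigraph_inc {e : Fin 23} {x : Fin 10} :
    baseMultigraph.Inc e x ↔ x = (baseEnds e).1 ∨ x = (baseEnds e).2 := by
  simp only [Inc, baseMultigraph_isLink]
  exact Sym2.mem_iff

theorem not_isLoopAt_baseMultigraph (e : Fin 23) (x : Fin 10) :
    ¬ baseMultigraph.IsLoopAt e x := by
  have h : ∀ e, (baseEnds e).1 ≠ (baseEnds e).2 := by decide +kernel
  intro he
  have := baseMultigraph_isLink.1 he
  exact h e (by rcases Sym2.eq_iff.1 this with h | h <;> rw [h.1, h.2])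

theorem conflict_rev_iff {e f : Fin 23} :
    conflict e.rev f.rev = true ↔
      e ≠ f ∧ ∃ x, baseMultigraph.Inc e x ∧ baseMultigraph.Inc f x := by
  simp only [baseMultigraph_inc]
  revert e f
  decide +kernel

/-- No colouring of the edges of `baseMultigraph` is a circular edge-colouring of circumference
less than `23 / 4`. -/
theorem le_of_isCircularEdgeColoring_baseMultigraph {r : ℝ} {c : Fin 23 → ℝ}
    (hc : ∀ e f x, e ≠ f → baseMultigraph.Inc e x → baseMultigraph.Inc f x →
      1 ≤ |c e - c f| ∧ |c e - c f| ≤ r - 1) : 23 / 4 ≤ r := by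
  by_contra! hr
  obtain ⟨d, hd⟩ := exists_int_coloring (by simp) hr
    (R := fun e f => e ≠ f ∧ ∃ x, baseMultigraph.Inc e x ∧ baseMultigraph.Inc f x)
    (fun e f h => ⟨h.1.symm, h.2.imp fun _ => And.symm⟩)
    (fun e f ⟨hef, x, he, hf⟩ => hc e f x hef he hf)
  refine IsModColoring.false (c := fun e => d e.rev) fun e f hef => ?_
  have := hd e.rev f.rev (conflict_rev_iff.1 (by simpa only [Fin.rev_rev] using hef))
  -- As 14 = 17 - 3, absolute differences between 3 and 14 have residues modulo 17 in the same
  -- range.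
  grind

/-- A colouring of the edges of `baseMultigraph` with the colours `0, …, 22`. -/
def baseColoring : Fin 23 → ℕ :=
  ![5, 18, 7, 11, 16, 2, 12, 21, 9, 19, 4, 0, 14, 1, 15, 10, 20, 6, 13, 8, 22, 3, 17]

theorem baseColoring_lt (e : Fin 23) : baseColoring e < 23 := by
  revert e
  decide +kernel

theorem baseColoring_dist {e f : Fin 23} {x : Fin 10} (hef : e ≠ f)
    (he : baseMultigraph.Inc e x) (hf : baseMultigraph.Inc f x) :
    (baseColoring e + 4 ≤ baseColoring f ∨ baseColoring f + 4 ≤ baseColoring e) ∧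
      baseColoring f + 4 ≤ baseColoring e + 23 := by
  have h : ∀ e f : Fin 23, conflict e.rev f.rev = true →
      (baseColoring e + 4 ≤ baseColoring f ∨ baseColoring f + 4 ≤ baseColoring e) ∧
      baseColoring f + 4 ≤ baseColoring e + 23 := by decide +kernel
  exact h e f (conflict_rev_iff.2 ⟨hef, x, he, hf⟩)

theorem circularChromaticIndex_baseMultigraph :
    baseMultigraph.circularChromaticIndex = 23 / 4 := by
  have hc : baseMultigraph.IsCircularEdgeColoring ((23 : ℕ) / (4 : ℕ)) _ :=
    isCircularEdgeColoring_div (c := baseColoring) (by norm_num) not_isLoopAt_baseMultigraph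
      (fun e _ => baseColoring_lt e) fun e f x => baseColoring_dist
  norm_num only [Nat.cast_ofNat] at hc
  refine le_antisymm (circularChromaticIndex_le (by norm_num) hc)
    (le_csInf ⟨_, by norm_num, _, hc⟩ ?_)
  rintro r ⟨-, c, hc⟩
  exact le_of_isCircularEdgeColoring_baseMultigraph hc.dist

/-- For every edge `e` of `baseMultigraph`, a colouring of the other edges with the colours
`0, …, 16`. -/
def deletedColoring : Fin 23 → Fin 23 → ℕ :=
  ![![0, 0, 3, 6, 9, 12, 1, 15, 3, 9, 12, 15, 6, 7, 0, 10, 13, 4, 10, 4, 13, 16, 7],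
    ![0, 0, 3, 6, 9, 12, 1, 15, 3, 9, 12, 15, 6, 7, 0, 10, 13, 4, 10, 4, 13, 16, 7],
    ![0, 3, 0, 7, 10, 13, 4, 7, 6, 0, 13, 3, 9, 9, 4, 12, 15, 1, 13, 16, 6, 2, 10],
    ![0, 3, 7, 0, 10, 13, 4, 7, 6, 0, 13, 3, 9, 9, 4, 12, 15, 1, 13, 16, 6, 2, 10],
    ![0, 3, 4, 7, 0, 15, 8, 11, 6, 12, 2, 15, 9, 9, 1, 12, 15, 5, 13, 16, 6, 10, 2],
    ![0, 3, 8, 11, 5, 0, 2, 12, 6, 1, 15, 12, 9, 10, 4, 13, 16, 7, 13, 9, 6, 2, 16],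
    ![0, 3, 5, 8, 11, 15, 0, 7, 6, 12, 2, 15, 9, 9, 1, 12, 15, 4, 13, 16, 6, 2, 10],
    ![0, 3, 5, 8, 11, 15, 7, 0, 6, 12, 2, 15, 9, 9, 1, 12, 15, 4, 13, 16, 6, 2, 10],
    ![0, 3, 3, 6, 9, 12, 1, 15, 0, 9, 12, 15, 6, 7, 0, 10, 13, 4, 10, 4, 13, 16, 7],
    ![0, 3, 1, 15, 12, 11, 5, 8, 6, 0, 2, 12, 9, 10, 7, 13, 4, 16, 13, 16, 6, 9, 2],
    ![0, 3, 1, 15, 4, 7, 10, 13, 6, 12, 0, 15, 9, 10, 4, 13, 7, 16, 13, 16, 6, 10, 2],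
    ![0, 3, 2, 5, 15, 13, 7, 10, 6, 9, 1, 0, 14, 9, 16, 6, 12, 3, 14, 4, 11, 8, 0],
    ![0, 3, 1, 7, 4, 13, 7, 10, 6, 10, 13, 16, 0, 9, 4, 12, 15, 1, 13, 16, 7, 10, 4],
    ![0, 3, 1, 4, 9, 10, 13, 6, 6, 13, 0, 3, 9, 0, 7, 12, 15, 2, 9, 3, 6, 12, 16],
    ![0, 3, 1, 4, 7, 7, 10, 13, 6, 12, 16, 2, 9, 9, 0, 12, 15, 2, 13, 2, 6, 10, 16],
    ![0, 3, 1, 4, 7, 7, 10, 13, 6, 15, 2, 9, 12, 9, 12, 0, 15, 1, 13, 16, 7, 10, 4],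
    ![0, 3, 1, 15, 5, 7, 10, 13, 6, 12, 2, 15, 9, 9, 4, 12, 0, 16, 12, 16, 6, 9, 2],
    ![0, 3, 1, 12, 5, 7, 10, 13, 6, 15, 2, 12, 9, 9, 4, 12, 15, 0, 12, 16, 6, 9, 2],
    ![0, 3, 5, 8, 12, 15, 1, 4, 6, 12, 15, 1, 9, 10, 2, 13, 16, 7, 0, 9, 6, 2, 12],
    ![0, 3, 4, 7, 1, 15, 7, 10, 6, 12, 15, 1, 9, 9, 1, 12, 15, 4, 13, 0, 6, 10, 1],
    ![0, 3, 1, 11, 5, 7, 10, 13, 6, 15, 2, 12, 9, 9, 4, 12, 15, 1, 12, 16, 0, 8, 4],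
    ![0, 3, 4, 10, 7, 7, 10, 13, 6, 13, 0, 3, 9, 9, 1, 12, 15, 4, 12, 3, 6, 0, 16],
    ![0, 3, 1, 12, 5, 7, 10, 13, 6, 15, 2, 12, 9, 9, 4, 12, 15, 1, 12, 16, 6, 9, 0]]

theorem deletedColoring_lt (e f : Fin 23) : deletedColoring e f < 17 := by
  revert e f
  decide +kernel

theorem deletedColoring_dist {a e f : Fin 23} (he : e ≠ a) (hf : f ≠ a)
    (h : conflict e.rev f.rev = true) :
    (deletedColoring a e + 3 ≤ deletedColoring a f ∨
      deletedColoring a f + 3 ≤ deletedColoring a e) ∧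
      deletedColoring a f + 3 ≤ deletedColoring a e + 17 := by
  revert a e f
  decide +kernel

theorem isCircularChromaticIndexCritical_baseMultigraph :
    baseMultigraph.IsCircularChromaticIndexCritical := by
  intro G hG
  obtain ⟨a, ha⟩ : ∃ a, a ∉ G.edgeSet := by
    by_contra! h
    -- There are no isolated vertices, so a subgraph with all the edges is not proper.
    refine hG.ne (Compatible.ext ?_ (Set.eq_univ_of_forall h) (Compatible.of_le hG.le))
    refine Set.eq_univ_of_forall fun x => ?_
    have hx : ∀ x : Fin 10, ∃ e : Fin 23, x = (baseEnds e).1 ∨ x = (baseEnds e).2 := by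
      decide +kernel
    obtain ⟨e, he⟩ := hx x
    obtain ⟨y, hy⟩ := baseMultigraph_inc.2 he
    exact ((IsSubgraph.isLink_iff hG.le (h e)).2 hy).left_mem
  have hc : G.IsCircularEdgeColoring ((17 : ℕ) / (3 : ℕ)) _ :=
    isCircularEdgeColoring_div (c := deletedColoring a) (by norm_num)
      (fun e x h => not_isLoopAt_baseMultigraph e x (h.mono hG.le))
      (fun e _ => deletedColoring_lt a e) fun e f x hef he hf =>
        deletedColoring_dist (fun h => ha (h ▸ he.edge_mem)) (fun h => ha (h ▸ hf.edge_mem))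
          (conflict_rev_iff.2 ⟨hef, x, he.mono hG.le, hf.mono hG.le⟩)
  rw [circularChromaticIndex_baseMultigraph]
  exact (circularChromaticIndex_le (by norm_num) hc).trans_lt (by norm_num)

theorem incidenceSet_baseMultigraph (x : Fin 10) :
    baseMultigraph.incidenceSet x = {e | x = (baseEnds e).1 ∨ x = (baseEnds e).2} :=
  Set.ext fun _ => baseMultigraph_inc

theorem encard_incidenceSet_baseMultigraph (x : Fin 10) :
    (baseMultigraph.incidenceSet x).encard =
      (Finset.univ.filter fun e => x = (baseEnds e).1 ∨ x = (baseEnds e).2).card := by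
  rw [incidenceSet_baseMultigraph, ← Set.encard_coe_eq_coe_finsetCard]
  simp

theorem degree_eq_encard_incidenceSet (h : ∀ e x, ¬ G.IsLoopAt e x) (x : α) :
    G.degree x = (G.incidenceSet x).encard := by
  have : G.loopSet x = ∅ := Set.eq_empty_of_forall_notMem fun e => h e x
  rw [degree, this, Set.encard_empty, add_zero]

theorem degree_baseMultigraph_three : baseMultigraph.degree 3 = 1 := by
  rw [degree_eq_encard_incidenceSet not_isLoopAt_baseMultigraph,
    encard_incidenceSet_baseMultigraph]
  norm_cast

end Graph

/-! ### The cycles of copies. -/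

namespace Graph

section CycleMultigraph

variable {k : ℕ}

theorem baseMultigraph_inc_three {e : Fin 23} (h : baseMultigraph.Inc e 3) : e = 11 := by
  rw [baseMultigraph_inc] at h
  revert e
  decide +kernel

theorem mem_vertexSet_cycleMultigraph (p : ZMod (2 * k) × Fin 10) :
    p ∈ (cycleMultigraph k).vertexSet :=
  Set.mem_univ p.2

theorem cycleMultigraph_isLink_inl {i : ZMod (2 * k)} {e : Fin 23}
    {p q : ZMod (2 * k) × Fin 10} :
    (cycleMultigraph k).IsLink (Sum.inl (i, e)) p q ↔
      p.1 = i ∧ q.1 = i ∧ baseMultigraph.IsLink e p.2 q.2 :=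
  Iff.rfl

theorem cycleMultigraph_isLink_inr {i : ZMod (2 * k)} {p q : ZMod (2 * k) × Fin 10} :
    (cycleMultigraph k).IsLink (Sum.inr i) p q ↔
      (p = (i, 3) ∧ q = (i + 1, 3)) ∨ (p = (i + 1, 3) ∧ q = (i, 3)) :=
  Iff.rfl

theorem cycleMultigraph_inc_inl {i : ZMod (2 * k)} {e : Fin 23} {p : ZMod (2 * k) × Fin 10} :
    (cycleMultigraph k).Inc (Sum.inl (i, e)) p ↔ p.1 = i ∧ baseMultigraph.Inc e p.2 := by
  constructor
  · rintro ⟨q, h₁, -, h₂⟩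
    exact ⟨h₁, q.2, h₂⟩
  · rintro ⟨h₁, y, h₂⟩
    exact ⟨(i, y), h₁, rfl, h₂⟩

theorem cycleMultigraph_inc_inr {i : ZMod (2 * k)} {p : ZMod (2 * k) × Fin 10} :
    (cycleMultigraph k).Inc (Sum.inr i) p ↔ p = (i, 3) ∨ p = (i + 1, 3) := by
  constructor
  · rintro ⟨q, h | h⟩
    exacts [Or.inl h.1, Or.inr h.1]
  · rintro (h | h)
    exacts [⟨_, Or.inl ⟨h, rfl⟩⟩, ⟨_, Or.inr ⟨h, rfl⟩⟩]

theorem not_isLoopAt_cycleMultigraph (hk : 1 ≤ k) (e : (ZMod (2 * k) × Fin 23) ⊕ ZMod (2 * k))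
    (p : ZMod (2 * k) × Fin 10) : ¬ (cycleMultigraph k).IsLoopAt e p := by
  have : Fact (1 < 2 * k) := ⟨by omega⟩
  rcases e with ⟨i, e⟩ | i
  · exact fun h => not_isLoopAt_baseMultigraph e p.2 h.2.2
  · rintro (⟨rfl, h⟩ | ⟨rfl, h⟩) <;> simp at h

/-- The parity of an element of `ZMod (2 * k)`. -/
def parity (k : ℕ) : ZMod (2 * k) →+* ZMod 2 := ZMod.castHom (dvd_mul_right 2 k) (ZMod 2)

/-- A colouring of the edges of `cycleMultigraph k` with the colours `0, …, 22`: every copy of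
`baseMultigraph` is coloured by `baseColoring`, and the colours `8` and `16` alternate along the
cycle. -/
def cycleColoring (k : ℕ) : (ZMod (2 * k) × Fin 23) ⊕ ZMod (2 * k) → ℕ
  | Sum.inl p => baseColoring p.2
  | Sum.inr i => if parity k i = 0 then 8 else 16

theorem cycleColoring_lt (e : (ZMod (2 * k) × Fin 23) ⊕ ZMod (2 * k)) :
    cycleColoring k e < 23 := by
  rcases e with ⟨i, e⟩ | i
  · exact baseColoring_lt e
  · rw [cycleColoring]
    split_ifs <;> norm_num

theorem cycleColoring_inr_add_one (i : ZMod (2 * k)) :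
    cycleColoring k (Sum.inr i) + cycleColoring k (Sum.inr (i + 1)) = 24 := by
  simp only [cycleColoring, map_add, map_one]
  generalize parity k i = a
  revert a
  decide

theorem cycleColoring_inr (i : ZMod (2 * k)) :
    cycleColoring k (Sum.inr i) = 8 ∨ cycleColoring k (Sum.inr i) = 16 := by
  rw [cycleColoring]
  split_ifs <;> simp

/-- At a vertex of the cycle the colours are 0, 8 and 16, with pairwise distances 8, 8 and 7 modulo
23. Elsewhere only one copy matters. -/
theorem cycleColoring_dist {e f : (ZMod (2 * k) × Fin 23) ⊕ ZMod (2 * k)}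
    {p : ZMod (2 * k) × Fin 10} (hef : e ≠ f) (he : (cycleMultigraph k).Inc e p)
    (hf : (cycleMultigraph k).Inc f p) :
    (cycleColoring k e + 4 ≤ cycleColoring k f ∨ cycleColoring k f + 4 ≤ cycleColoring k e) ∧
      cycleColoring k f + 4 ≤ cycleColoring k e + 23 := by
  have hthree : ∀ {i j e}, (cycleMultigraph k).Inc (Sum.inl (i, e)) (j, 3) →
      cycleColoring k (Sum.inl (i, e)) = 0 := fun h => by
    rw [baseMultigraph_inc_three (cycleMultigraph_inc_inl.1 h).2]
    rfl
  rcases e with ⟨i, e⟩ | i <;> rcases f with ⟨j, f⟩ | j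
  · rw [cycleMultigraph_inc_inl] at he hf
    exact baseColoring_dist (fun h : e = f => hef (by rw [← he.1, ← hf.1, h])) he.2 hf.2
  · have h := cycleColoring_inr j
    rcases cycleMultigraph_inc_inr.1 hf with rfl | rfl <;> rw [hthree he] <;> omega
  · have h := cycleColoring_inr i
    rcases cycleMultigraph_inc_inr.1 he with rfl | rfl <;> rw [hthree hf] <;> omega
  · have h₁ := cycleColoring_inr i
    have h₂ : cycleColoring k (Sum.inr i) + cycleColoring k (Sum.inr j) = 24 := by
      rcases cycleMultigraph_inc_inr.1 he with rfl | rfl <;>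
        rcases cycleMultigraph_inc_inr.1 hf with h | h <;>
        obtain ⟨h, -⟩ := Prod.mk.inj h
      · exact (hef (by rw [h])).elim
      · rw [h, add_comm, cycleColoring_inr_add_one]
      · rw [← h, cycleColoring_inr_add_one]
      · exact (hef (by rw [add_right_cancel h])).elim
    omega

theorem circularChromaticIndex_cycleMultigraph (hk : 1 ≤ k) :
    (cycleMultigraph k).circularChromaticIndex = 23 / 4 := by
  have hc : (cycleMultigraph k).IsCircularEdgeColoring ((23 : ℕ) / (4 : ℕ)) _ :=
    isCircularEdgeColoring_div (c := cycleColoring k) (by norm_num)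
      (not_isLoopAt_cycleMultigraph hk) (fun e _ => cycleColoring_lt e)
      fun e f x => cycleColoring_dist
  norm_num only [Nat.cast_ofNat] at hc
  refine le_antisymm (circularChromaticIndex_le (by norm_num) hc)
    (le_csInf ⟨_, by norm_num, _, hc⟩ ?_)
  rintro r ⟨-, c, hc⟩
  -- The restriction to the copy with index 0 gives the lower bound.
  refine le_of_isCircularEdgeColoring_baseMultigraph (c := fun e => c (Sum.inl (0, e)))
    fun e f x hef he hf => hc.dist _ _ (0, x) (by simpa using hef) ?_ ?_
  exacts [cycleMultigraph_inc_inl.2 ⟨rfl, he⟩, cycleMultigraph_inc_inl.2 ⟨rfl, hf⟩]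

theorem encard_incidenceSet_baseMultigraph_le (x : Fin 10) :
    (baseMultigraph.incidenceSet x).encard ≤ 5 := by
  have h : ∀ x, (Finset.univ.filter fun e => x = (baseEnds e).1 ∨ x = (baseEnds e).2).card ≤ 5 := by
    decide +kernel
  rw [encard_incidenceSet_baseMultigraph]
  exact_mod_cast h x

theorem incidenceSet_cycleMultigraph (p : ZMod (2 * k) × Fin 10) (hp : p.2 ≠ 3) :
    (cycleMultigraph k).incidenceSet p =
      (fun e => Sum.inl (p.1, e)) '' baseMultigraph.incidenceSet p.2 := by
  ext d
  rw [mem_incidenceSet, Set.mem_image]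
  constructor
  · intro h
    rcases d with ⟨i, e⟩ | i
    · rw [cycleMultigraph_inc_inl] at h
      exact ⟨e, h.2, by rw [h.1]⟩
    · rw [cycleMultigraph_inc_inr] at h
      rcases h with rfl | rfl <;> exact (hp rfl).elim
  · rintro ⟨e, he, rfl⟩
    exact cycleMultigraph_inc_inl.2 ⟨rfl, he⟩

theorem encard_incidenceSet_cycleMultigraph (p : ZMod (2 * k) × Fin 10) (hp : p.2 ≠ 3) :
    ((cycleMultigraph k).incidenceSet p).encard = (baseMultigraph.incidenceSet p.2).encard := by
  rw [incidenceSet_cycleMultigraph p hp]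
  exact Function.Injective.encard_image (fun e f h => by simpa using h) _

theorem encard_incidenceSet_cycleMultigraph_le (p : ZMod (2 * k) × Fin 10) :
    ((cycleMultigraph k).incidenceSet p).encard ≤ 5 := by
  obtain ⟨i, x⟩ := p
  by_cases hx : x = 3
  · subst hx
    have h : (cycleMultigraph k).incidenceSet (i, 3) ⊆
        {Sum.inl (i, 11), Sum.inr i, Sum.inr (i - 1)} := by
      rintro (⟨j, e⟩ | j) h <;> rw [mem_incidenceSet] at h
      · rw [baseMultigraph_inc_three (cycleMultigraph_inc_inl.1 h).2,
          ← (cycleMultigraph_inc_inl.1 h).1]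
        exact Or.inl rfl
      · rw [cycleMultigraph_inc_inr] at h
        rcases h with h | h <;> rw [(Prod.mk.inj h).1] <;> simp
    refine (Set.encard_le_encard h).trans ?_
    refine (Set.encard_insert_le _ _).trans ?_
    refine (add_le_add_left (Set.encard_insert_le _ _) _).trans ?_
    rw [Set.encard_singleton]
    norm_num
  · rw [encard_incidenceSet_cycleMultigraph _ hx]
    exact encard_incidenceSet_baseMultigraph_le x

theorem maxDegree_cycleMultigraph (hk : 1 ≤ k) : (cycleMultigraph k).maxDegree = 5 := by
  have hdeg := degree_eq_encard_incidenceSet (not_isLoopAt_cycleMultigraph hk)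
  refine le_antisymm (iSup₂_le fun p _ => ?_) ?_
  · rw [hdeg]
    exact encard_incidenceSet_cycleMultigraph_le p
  -- The vertex 0 of a copy has degree 5.
  · refine le_iSup₂_of_le (0, 0) (mem_vertexSet_cycleMultigraph _) ?_
    rw [hdeg, encard_incidenceSet_cycleMultigraph (0, 0) (show (0 : Fin 10) ≠ 3 by decide),
      encard_incidenceSet_baseMultigraph]
    norm_cast

theorem reflTransGen_adj_baseMultigraph (x : Fin 10) :
    Relation.ReflTransGen baseMultigraph.Adj x 3 := by
  -- Pointers along edges that lead from every vertex to 3 in at most three steps.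
  let next : Fin 10 → Fin 10 := ![7, 7, 7, 3, 7, 1, 1, 3, 0, 0]
  have hnext : ∀ x, x = 3 ∨ ∃ e : Fin 23,
      s((baseEnds e).1, (baseEnds e).2) = s(x, next x) := by decide +kernel
  have step : ∀ x, Relation.ReflTransGen baseMultigraph.Adj x (next x) := fun x => by
    rcases hnext x with rfl | ⟨e, he⟩
    · exact Relation.ReflTransGen.refl
    · exact Relation.ReflTransGen.single ⟨e, baseMultigraph_isLink.2 he⟩
  have h : ∀ x, next (next (next x)) = 3 := by decide +kernel
  rw [← h x]
  exact ((step _).trans (step _)).trans (step _)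

theorem connected_cycleMultigraph (hk : 1 ≤ k) : (cycleMultigraph k).Connected := by
  have : NeZero (2 * k) := ⟨by omega⟩
  have : Std.Symm (cycleMultigraph k).Adj := ⟨fun _ _ h => h.symm⟩
  have hsymm : ∀ {p q}, Relation.ReflTransGen (cycleMultigraph k).Adj p q →
      Relation.ReflTransGen (cycleMultigraph k).Adj q p := fun {p q} =>
    Relation.ReflTransGen.stdSymm.symm p q
  have hcycle : ∀ m : ℕ, Relation.ReflTransGen (cycleMultigraph k).Adj (0, 3) ((m : ZMod _), 3) := by
    intro m
    induction m with
    | zero => rw [Nat.cast_zero]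
    | succ m ih =>
      refine ih.tail ⟨Sum.inr m, cycleMultigraph_isLink_inr.2 (Or.inl ⟨rfl, ?_⟩)⟩
      rw [Nat.cast_succ]
  have hzero : ∀ p, Relation.ReflTransGen (cycleMultigraph k).Adj p (0, 3) := by
    rintro ⟨i, x⟩
    have h : Relation.ReflTransGen (cycleMultigraph k).Adj (i, x) (i, 3) :=
      (reflTransGen_adj_baseMultigraph x).lift (fun x => (i, x)) fun _ _ ⟨e, he⟩ =>
        ⟨Sum.inl (i, e), cycleMultigraph_isLink_inl.2 ⟨rfl, rfl, he⟩⟩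
    refine h.trans (hsymm ?_)
    have := hcycle i.val
    rwa [ZMod.natCast_zmod_val] at this
  exact ⟨⟨(0, 3), mem_vertexSet_cycleMultigraph _⟩,
    fun p _ q _ => (hzero p).trans (hsymm (hzero q))⟩

/-- The edge between the vertices 3 and 7 of a copy is a bridge: without it, no walk from the vertex
0 of that copy reaches the vertex 3. -/
theorem not_connected_deleteEdges_cycleMultigraph :
    ¬ ((cycleMultigraph k).deleteEdges {Sum.inl (0, 11)}).Connected := by
  rintro ⟨-, h⟩
  have hinv : ∀ p, Relation.ReflTransGen
      ((cycleMultigraph k).deleteEdges {Sum.inl (0, 11)}).Adj (0, 0) p → p.1 = 0 ∧ p.2 ≠ 3 := by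
    intro p hp
    induction hp with
    | refl => exact ⟨rfl, (show (0 : Fin 10) ≠ 3 by decide)⟩
    | tail _ h ih =>
      obtain ⟨d, hd⟩ := h
      have hd₁ := (deleteEdges_inc.1 hd.inc_left).2
      have hd₂ := hd.mono deleteEdges_le
      rcases d with ⟨i, e⟩ | i
      · rw [cycleMultigraph_isLink_inl] at hd₂
        obtain ⟨h₁, h₂, h₃⟩ := hd₂
        have hi : i = 0 := h₁.symm.trans ih.1
        refine ⟨h₂.trans hi, fun h => hd₁ ?_⟩
        have he := h₃.inc_right
        rw [h] at he
        rw [baseMultigraph_inc_three he, hi]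
        rfl
      · rcases cycleMultigraph_isLink_inr.1 hd₂ with ⟨rfl, -⟩ | ⟨rfl, -⟩ <;>
          exact (ih.2 rfl).elim
  exact (hinv (0, 3) (h _ (mem_vertexSet_cycleMultigraph _) _
    (mem_vertexSet_cycleMultigraph _))).2 rfl

theorem edgeConnectivity_cycleMultigraph (hk : 1 ≤ k) :
    (cycleMultigraph k).edgeConnectivity = 1 := by
  refine le_antisymm (sSup_le fun n hn => ?_) (le_sSup ⟨?_, fun F _ hF => ?_⟩)
  · by_contra! h
    refine not_connected_deleteEdges_cycleMultigraph (hn.2 {Sum.inl (0, 11)} ?_ ?_)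
    · rw [Set.singleton_subset_iff]
      exact fun _ _ => Set.mem_univ _
    · rwa [Set.encard_singleton]
  · exact ⟨(0, 0), mem_vertexSet_cycleMultigraph _, (0, 1), mem_vertexSet_cycleMultigraph _,
      by simp⟩
  · rw [Order.lt_one_iff, Set.encard_eq_zero] at hF
    rw [hF, deleteEdges_empty]
    exact connected_cycleMultigraph hk

theorem natCard_vertexSet_cycleMultigraph (k : ℕ) :
    Nat.card (cycleMultigraph k).vertexSet = 2 * k * 10 := by
  have : (cycleMultigraph k).vertexSet = Set.univ :=
    Set.eq_univ_of_forall mem_vertexSet_cycleMultigraph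
  rw [this, Nat.card_coe_set_eq, Set.ncard_univ, Nat.card_prod, Nat.card_zmod,
    Nat.card_eq_fintype_card, Fintype.card_fin]

end CycleMultigraph

end Graph

theorem mainTheorem6 :
    -- the building block: critical, of index `23 / 4`, and `3` is a vertex of degree `1`
    (Graph.baseMultigraph.circularChromaticIndex = 23 / 4 ∧
      Graph.baseMultigraph.IsCircularChromaticIndexCritical ∧
      Graph.baseMultigraph.degree 3 = 1) ∧
    -- the members of the family are finite multigraphs with the required invariants
    (∀ k : ℕ, 2 ≤ k →
      (Graph.cycleMultigraph k).vertexSet.Finite ∧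
      (Graph.cycleMultigraph k).edgeSet.Finite ∧
      (Graph.cycleMultigraph k).maxDegree = 5 ∧
      (Graph.cycleMultigraph k).edgeConnectivity = 1 ∧
      (Graph.cycleMultigraph k).circularChromaticIndex = 23 / 4) ∧
    -- they are pairwise non-isomorphic, so there are infinitely many
    (∀ k l : ℕ, 2 ≤ k → 2 ≤ l → k ≠ l →
      IsEmpty (Graph.Iso (Graph.cycleMultigraph k) (Graph.cycleMultigraph l))) := by
  refine ⟨⟨Graph.circularChromaticIndex_baseMultigraph,
    Graph.isCircularChromaticIndexCritical_baseMultigraph, Graph.degree_baseMultigraph_three⟩,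
    fun k hk => ?_, fun k l _ _ hkl => ⟨fun φ => hkl ?_⟩⟩
  · have : NeZero (2 * k) := ⟨by omega⟩
    have hk' : 1 ≤ k := by omega
    exact ⟨Set.toFinite _, Set.toFinite _, Graph.maxDegree_cycleMultigraph hk',
      Graph.edgeConnectivity_cycleMultigraph hk', Graph.circularChromaticIndex_cycleMultigraph hk'⟩
  -- The number of vertices, 20k, determines k.
  · have h := Nat.card_congr φ.vertexEquiv
    rw [Graph.natCard_vertexSet_cycleMultigraph, Graph.natCard_vertexSet_cycleMultigraph] at h
    omega
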